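/- For positive definite complex $n\times n$ matrices $A,B$ let $$A\#B := A^{1/2}\,(A^{-1/2} B A^{-1/2})^{1/2}\,A^{1/2}$$ be their (Kubo–Ando) geometric mean, and for positive semidefinite $A,B$ of which at least one is singular let $A\#B := \lim_{\varepsilon\downarrow 0}\,(A+\varepsilon I)\#(B+\varepsilon I)$. Let $A$ and $B$ be positive semidefinite complex $n\times n$ matrices. Then $(A+\varepsilon I)\#(B+\varepsilon I)\to A\#B$ as $\varepsilon\downarrow 0$ (in particular the limit that defines $A\#B$ exists), the numbers $\det(I+A\#B)$ and $\det(I+A^{1/2}B^{1/2})$ are real, and $$\det(I+A\#B)\le\det(I+A^{1/2}B^{1/2}).$$ -/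

import Mathlib

open scoped ComplexOrder MatrixOrder Topology
open Filter

namespace Matrix

variable {n : Type*} [Fintype n] [DecidableEq n]

/-- The expression `A^{1/2} (A^{-1/2} B A^{-1/2})^{1/2} A^{1/2}`, which is the geometric mean
of `A` and `B` when both are positive definite. -/
noncomputable def geometricMeanFormula (A B : Matrix n n ℂ) : Matrix n n ℂ :=
  CFC.sqrt A * CFC.sqrt ((CFC.sqrt A)⁻¹ * B * (CFC.sqrt A)⁻¹) * CFC.sqrt A

/-- The perturbed means `(A + ε I) # (B + ε I)`; for positive semidefinite `A`, `B` and `ε > 0`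
both arguments are positive definite. -/
noncomputable def perturbedGeometricMean (A B : Matrix n n ℂ) (ε : ℝ) : Matrix n n ℂ :=
  geometricMeanFormula (A + ε • (1 : Matrix n n ℂ)) (B + ε • (1 : Matrix n n ℂ))

open Classical in
/-- The Kubo–Ando geometric mean `A # B` of positive semidefinite matrices: given by the explicit
formula if both matrices are positive definite, and by the limit of `(A + ε I) # (B + ε I)` as
`ε ↓ 0` if one of them is rank-deficient. -/
noncomputable def geometricMean (A B : Matrix n n ℂ) : Matrix n n ℂ :=
  if A.PosDef ∧ B.PosDef then geometricMeanFormula A B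
  else limUnder (𝓝[>] (0 : ℝ)) (perturbedGeometricMean A B)

end Matrix

/-!
Write `P = A^{1/2}`, `Q = B^{1/2}` and `Z = A # B`, with `A` and `B` positive definite. The Riccati
equation `Z A⁻¹ Z = B` (`PosDef.geometricMeanFormula_riccati`) says that `V = P⁻¹ Z Q⁻¹` is unitary,
and `Z = P V Q`. The Cauchy–Schwarz inequality for determinants
`|det (1 + Sᴴ T)|² ≤ det (1 + Sᴴ S) det (1 + Tᴴ T)` (`star_det_mul_det_one_add_le`), applied to
`S = P^{1/2} Q^{1/2}` and `T = P^{1/2} V Q^{1/2}`, becomes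
`det (1 + Z)² ≤ det (1 + P Q) det (1 + Vᴴ P V Q)` once the factors are permuted cyclically. Here
`Vᴴ P V Q = Vᴴ Z`, and the same Cauchy–Schwarz inequality bounds `|det (1 + Vᴴ Z)|` by
`det (1 + Z)`. Cancelling one factor `det (1 + Z)` gives the claim
(`PosSemidef.det_one_add_le_of_riccati`).

In general, `(A + ε I) # (B + ε I)` is monotone in `ε`: a geometric mean is the largest solution of
the Riccati inequality `Z A⁻¹ Z ≤ B` (`PosDef.le_geometricMeanFormula`), and this inequality is
preserved when `A` and `B` increase. A monotone family of positive semidefinite matrices converges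
as `ε ↓ 0` (`exists_tendsto_of_monotoneOn`), so the limit defining `A # B` exists. If `A` and `B`
are positive definite, the limit is the explicit formula by continuity of square root and inverse.
The inequality for `ε > 0` then passes to the limit.
-/

namespace Matrix

variable {n : Type*} [Fintype n] [DecidableEq n]

/-! ### Square roots, inverses and determinants of positive matrices -/

lemma PosDef.sqrt {A : Matrix n n ℂ} (hA : A.PosDef) : (CFC.sqrt A).PosDef :=
  isStrictlyPositive_iff_posDef.mp (IsStrictlyPositive.sqrt A hA.isStrictlyPositive)

lemma posSemidef_sqrt (A : Matrix n n ℂ) : (CFC.sqrt A).PosSemidef :=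
  nonneg_iff_posSemidef.mp (CFC.sqrt_nonneg A)

lemma PosSemidef.sqrt_mul_sqrt {A : Matrix n n ℂ} (hA : A.PosSemidef) :
    CFC.sqrt A * CFC.sqrt A = A :=
  CFC.sqrt_mul_sqrt_self A hA.nonneg

lemma PosDef.mul_inv {A : Matrix n n ℂ} (hA : A.PosDef) : A * A⁻¹ = 1 :=
  mul_nonsing_inv A hA.det_pos.ne'.isUnit

lemma PosDef.inv_mul {A : Matrix n n ℂ} (hA : A.PosDef) : A⁻¹ * A = 1 :=
  nonsing_inv_mul A hA.det_pos.ne'.isUnit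

omit [Fintype n] in
lemma PosSemidef.add_smul_one_posDef {A : Matrix n n ℂ} (hA : A.PosSemidef) {ε : ℝ} (hε : 0 < ε) :
    (A + ε • (1 : Matrix n n ℂ)).PosDef :=
  PosDef.posSemidef_add hA (PosDef.one.smul hε)

lemma PosSemidef.one_le_det_one_add {E : Matrix n n ℂ} (hE : E.PosSemidef) :
    1 ≤ (1 + E).det := by
  have h : 1 + E = Unitary.conjStarAlgAut ℂ _ hE.1.eigenvectorUnitary
      (diagonal fun i => 1 + (hE.1.eigenvalues i : ℂ)) := by
    conv_lhs => rw [hE.1.spectral_theorem]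
    rw [← diagonal_add (fun _ => 1), map_add, diagonal_one, map_one]
    rfl
  have hd : (1 + E).det = ((∏ i, (1 + hE.1.eigenvalues i) : ℝ) : ℂ) := by
    rw [h, Unitary.conjStarAlgAut_apply, det_mul_right_comm]
    simp
  rw [hd]
  have : (1 : ℝ) ≤ ∏ i, (1 + hE.1.eigenvalues i) :=
    Finset.one_le_prod fun i _ => le_add_of_nonneg_right (hE.eigenvalues_nonneg i)
  exact_mod_cast this

/-- The determinant is monotone above a positive definite matrix `X`: with `R = X^{1/2}`,
`det Y = det X * det (1 + R⁻¹ (Y - X) R⁻¹)`. -/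
lemma PosDef.det_le_det {X Y : Matrix n n ℂ} (hX : X.PosDef) (hXY : X ≤ Y) : X.det ≤ Y.det := by
  have hR := hX.sqrt
  have hRR := hX.posSemidef.sqrt_mul_sqrt
  set R := CFC.sqrt X
  have hE : (R⁻¹ * (Y - X) * R⁻¹).PosSemidef := by
    have := (le_iff.mp hXY).mul_mul_conjTranspose_same R⁻¹
    rwa [hR.inv.1.eq] at this
  have hY : R * (1 + R⁻¹ * (Y - X) * R⁻¹) * R = Y := by
    calc _ = R * R + (R * R⁻¹) * (Y - X) * (R⁻¹ * R) := by noncomm_ring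
      _ = Y := by rw [hR.mul_inv, hR.inv_mul, hRR]; simp
  calc X.det ≤ X.det * (1 + R⁻¹ * (Y - X) * R⁻¹).det :=
        le_mul_of_one_le_right hX.det_pos.le hE.one_le_det_one_add
    _ = Y.det := by
        rw [← congrArg det hY, det_mul, det_mul, ← congrArg det hRR, det_mul]; ring

lemma posDef_one_add_conjTranspose_mul_self (S : Matrix n n ℂ) : (1 + Sᴴ * S).PosDef :=
  PosDef.one.add_posSemidef (posSemidef_conjTranspose_mul_self S)

/-- A Cauchy–Schwarz inequality for determinants: the four matrices `1 + Xᴴ Y` with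
`X, Y ∈ {S, T}` are the blocks of a Gram matrix, so that the Schur complement
`1 + Tᴴ T - (1 + Sᴴ T)ᴴ (1 + Sᴴ S)⁻¹ (1 + Sᴴ T)` is positive semidefinite. -/
lemma star_det_mul_det_one_add_le (S T : Matrix n n ℂ) :
    star (1 + Sᴴ * T).det * (1 + Sᴴ * T).det ≤ (1 + Sᴴ * S).det * (1 + Tᴴ * T).det := by
  have hM := posDef_one_add_conjTranspose_mul_self S
  have hK := posDef_one_add_conjTranspose_mul_self T
  by_cases h0 : (1 + Sᴴ * T).det = 0
  · rw [h0, mul_zero]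
    exact mul_nonneg hM.det_pos.le hK.det_pos.le
  have hblock : (fromBlocks (1 + Sᴴ * S) (1 + Sᴴ * T) (1 + Sᴴ * T)ᴴ (1 + Tᴴ * T)).PosSemidef := by
    have := posSemidef_conjTranspose_mul_self (fromBlocks 1 1 S T : Matrix (n ⊕ n) (n ⊕ n) ℂ)
    rw [fromBlocks_conjTranspose, fromBlocks_multiply] at this
    simpa using this
  have := hM.isUnit.invertible
  have hschur := (PosDef.fromBlocks₁₁ _ _ hM).mp hblock
  have hN : ((1 + Sᴴ * T)ᴴ * (1 + Sᴴ * S)⁻¹ * (1 + Sᴴ * T)).PosDef := by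
    refine hM.inv.conjTranspose_mul_mul_same ?_
    exact mulVec_injective_iff_isUnit.mpr ((isUnit_iff_isUnit_det _).mpr (Ne.isUnit h0))
  have hle := hN.det_le_det (le_iff.mpr hschur)
  rw [det_mul, det_mul, det_conjTranspose] at hle
  have hMdet : (1 + Sᴴ * S).det * (1 + Sᴴ * S)⁻¹.det = 1 := by
    rw [← det_mul, hM.mul_inv, det_one]
  calc _ = (1 + Sᴴ * S).det * (star (1 + Sᴴ * T).det * (1 + Sᴴ * S)⁻¹.det * (1 + Sᴴ * T).det) := by
        linear_combination (-star (1 + Sᴴ * T).det * (1 + Sᴴ * T).det) * hMdet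
    _ ≤ _ := mul_le_mul_of_nonneg_left hle hM.det_pos.le

/-- A unitary factor does not increase `|det (1 + Z)|` for positive semidefinite `Z`. -/
lemma PosSemidef.star_det_one_add_unitary_mul_le {Z V : Matrix n n ℂ} (hZ : Z.PosSemidef)
    (hV : Vᴴ * V = 1) :
    star (1 + V * Z).det * (1 + V * Z).det ≤ (1 + Z).det * (1 + Z).det := by
  have h := star_det_mul_det_one_add_le (CFC.sqrt Z) (V * CFC.sqrt Z)
  have hzz := hZ.sqrt_mul_sqrt
  rw [conjTranspose_mul, (posSemidef_sqrt Z).1.eq, hzz] at h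
  rwa [show CFC.sqrt Z * Vᴴ * (V * CFC.sqrt Z) = Z by
      rw [mul_assoc, ← mul_assoc Vᴴ, hV, one_mul, hzz],
    det_one_add_mul_comm, mul_assoc, hzz] at h

/-! ### The determinantal inequality for positive definite matrices -/

/-- If `Z (P P)⁻¹ Z = Q Q` then `V = P⁻¹ Z Q⁻¹` is unitary and `Z = P V Q = Q Vᴴ P`. The
Cauchy–Schwarz inequality for `P^{1/2} Q^{1/2}` and `P^{1/2} V Q^{1/2}` bounds `det (1 + Z) ^ 2` by
`det (1 + P Q) * det (1 + Vᴴ Z)`, and the last factor is at most `det (1 + Z)`. -/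
lemma PosSemidef.det_one_add_le_of_riccati {P Q Z : Matrix n n ℂ} (hP : P.PosDef) (hQ : Q.PosDef)
    (hZ : Z.PosSemidef) (h : Z * (P * P)⁻¹ * Z = Q * Q) :
    (1 + Z).det ≤ (1 + P * Q).det := by
  set V := P⁻¹ * Z * Q⁻¹ with hVdef
  have hVstar : Vᴴ = Q⁻¹ * Z * P⁻¹ := by
    simp only [hVdef, conjTranspose_mul, hP.inv.1.eq, hQ.inv.1.eq, hZ.1.eq, mul_assoc]
  have hVV : Vᴴ * V = 1 := by
    rw [mul_inv_rev] at h
    calc Vᴴ * V = Q⁻¹ * (Z * (P⁻¹ * P⁻¹) * Z) * Q⁻¹ := by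
          rw [hVstar, hVdef]; simp only [mul_assoc]
      _ = (Q⁻¹ * Q) * (Q * Q⁻¹) := by rw [h]; simp only [mul_assoc]
      _ = 1 := by rw [hQ.inv_mul, hQ.mul_inv, one_mul]
  have hPVQ : P * V * Q = Z := by
    calc P * V * Q = (P * P⁻¹) * Z * (Q⁻¹ * Q) := by rw [hVdef]; simp only [mul_assoc]
      _ = Z := by rw [hP.mul_inv, hQ.inv_mul, one_mul, mul_one]
  have hp := (posSemidef_sqrt P).1.eq
  have hq := (posSemidef_sqrt Q).1.eq
  have hpp := hP.posSemidef.sqrt_mul_sqrt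
  have hqq := hQ.posSemidef.sqrt_mul_sqrt
  set p := CFC.sqrt P
  set q := CFC.sqrt Q
  -- All three determinants of the Cauchy–Schwarz inequality have the form `det (1 + q W q)`.
  have hcyc (W : Matrix n n ℂ) : (1 + q * (W * q)).det = (1 + W * Q).det := by
    rw [det_one_add_mul_comm, mul_assoc, hqq]
  have hST : (1 + (p * q)ᴴ * (p * V * q)).det = (1 + Z).det := by
    rw [← hPVQ, ← hcyc, conjTranspose_mul, hp, hq, ← hpp]; simp only [mul_assoc]
  have hSS : (1 + (p * q)ᴴ * (p * q)).det = (1 + P * Q).det := by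
    rw [← hcyc, conjTranspose_mul, hp, hq, ← hpp]; simp only [mul_assoc]
  have hTT : (1 + (p * V * q)ᴴ * (p * V * q)).det = (1 + Vᴴ * Z).det := by
    rw [← hPVQ, ← mul_assoc Vᴴ, ← hcyc, conjTranspose_mul, conjTranspose_mul, hp, hq, ← hpp]
    simp only [mul_assoc]
  have h1 := star_det_mul_det_one_add_le (p * q) (p * V * q)
  have hVV' : Vᴴᴴ * Vᴴ = 1 := by rw [conjTranspose_conjTranspose]; exact mul_eq_one_comm.mp hVV
  have h2 := hZ.star_det_one_add_unitary_mul_le hVV'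
  have hd := hZ.one_le_det_one_add
  have he : 0 ≤ (1 + P * Q).det := hSS ▸ (posDef_one_add_conjTranspose_mul_self _).det_pos.le
  have hk : 0 ≤ (1 + Vᴴ * Z).det := hTT ▸ (posDef_one_add_conjTranspose_mul_self _).det_pos.le
  rw [hST, hSS, hTT] at h1
  -- All determinants are real, so the rest takes place in `ℝ`.
  generalize (1 + Z).det = d at h1 h2 hd ⊢
  generalize (1 + P * Q).det = e at h1 he ⊢
  generalize (1 + Vᴴ * Z).det = k at h1 h2 hk
  obtain ⟨d, rfl⟩ : ∃ r : ℝ, d = r :=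
    ⟨d.re, Complex.eq_re_of_ofReal_le (r := 1) (by simpa using hd)⟩
  obtain ⟨e, rfl⟩ : ∃ r : ℝ, e = r :=
    ⟨e.re, Complex.eq_re_of_ofReal_le (r := 0) (by simpa using he)⟩
  obtain ⟨k, rfl⟩ : ∃ r : ℝ, k = r :=
    ⟨k.re, Complex.eq_re_of_ofReal_le (r := 0) (by simpa using hk)⟩
  rw [← starRingEnd_apply, Complex.conj_ofReal] at h1 h2
  norm_cast at h1 h2 hd he hk ⊢
  have hkd : k ≤ d := by nlinarith
  have hdd : d * d ≤ e * d := h1.trans (mul_le_mul_of_nonneg_left hkd he)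
  exact le_of_mul_le_mul_right hdd (zero_lt_one.trans_le hd)

/-! ### The geometric mean of positive definite matrices -/

lemma posSemidef_geometricMeanFormula (A B : Matrix n n ℂ) :
    (geometricMeanFormula A B).PosSemidef := by
  have := (posSemidef_sqrt ((CFC.sqrt A)⁻¹ * B * (CFC.sqrt A)⁻¹)).mul_mul_conjTranspose_same
    (CFC.sqrt A)
  rwa [(posSemidef_sqrt A).1.eq] at this

/-- The geometric mean solves the Riccati equation `Z A⁻¹ Z = B`. -/
lemma PosDef.geometricMeanFormula_riccati {A B : Matrix n n ℂ} (hA : A.PosDef)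
    (hB : B.PosSemidef) :
    geometricMeanFormula A B * A⁻¹ * geometricMeanFormula A B = B := by
  have hR := hA.sqrt
  have hRR := hA.posSemidef.sqrt_mul_sqrt
  unfold geometricMeanFormula
  set R := CFC.sqrt A
  have hCC : CFC.sqrt (R⁻¹ * B * R⁻¹) * CFC.sqrt (R⁻¹ * B * R⁻¹) = R⁻¹ * B * R⁻¹ := by
    refine PosSemidef.sqrt_mul_sqrt ?_
    have := hB.mul_mul_conjTranspose_same R⁻¹
    rwa [hR.inv.1.eq] at this
  set C := CFC.sqrt (R⁻¹ * B * R⁻¹)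
  calc R * C * R * A⁻¹ * (R * C * R)
      = R * C * ((R * R⁻¹) * (R⁻¹ * R)) * C * R := by
        rw [← hRR, mul_inv_rev]; simp only [mul_assoc]
    _ = R * (C * C) * R := by rw [hR.mul_inv, hR.inv_mul]; simp only [mul_assoc, one_mul]
    _ = (R * R⁻¹) * B * (R⁻¹ * R) := by rw [hCC]; simp only [mul_assoc]
    _ = B := by rw [hR.mul_inv, hR.inv_mul, one_mul, mul_one]

lemma PosDef.det_one_add_geometricMeanFormula_le {A B : Matrix n n ℂ} (hA : A.PosDef)
    (hB : B.PosDef) :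
    (1 + geometricMeanFormula A B).det ≤ (1 + CFC.sqrt A * CFC.sqrt B).det := by
  refine (posSemidef_geometricMeanFormula A B).det_one_add_le_of_riccati hA.sqrt hB.sqrt ?_
  rw [hA.posSemidef.sqrt_mul_sqrt, hB.posSemidef.sqrt_mul_sqrt,
    hA.geometricMeanFormula_riccati hB.posSemidef]

open scoped Norms.L2Operator in
lemma PosDef.inv_le_inv {A A' : Matrix n n ℂ} (hA : A.PosDef) (h : A ≤ A') : A'⁻¹ ≤ A⁻¹ := by
  rw [nonsing_inv_eq_ringInverse, nonsing_inv_eq_ringInverse]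
  exact CStarAlgebra.ringInverse_le_ringInverse h hA.isStrictlyPositive

open scoped Norms.L2Operator in
lemma sqrt_le_sqrt {A B : Matrix n n ℂ} (h : A ≤ B) : CFC.sqrt A ≤ CFC.sqrt B :=
  CFC.sqrt_le_sqrt A B h

open scoped Norms.L2Operator in
lemma continuousOn_sqrt : ContinuousOn CFC.sqrt {A : Matrix n n ℂ | A.PosSemidef} := by
  simpa only [nonneg_iff_posSemidef] using CFC.continuousOn_sqrt (A := Matrix n n ℂ)

/-- The geometric mean is the largest positive semidefinite solution of `Z A⁻¹ Z ≤ B`: the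
inequality says `(A^{-1/2} Z A^{-1/2})² ≤ A^{-1/2} B A^{-1/2}`, and the square root is
operator monotone. -/
lemma PosDef.le_geometricMeanFormula {A B Z : Matrix n n ℂ} (hA : A.PosDef) (hZ : Z.PosSemidef)
    (h : Z * A⁻¹ * Z ≤ B) : Z ≤ geometricMeanFormula A B := by
  have hR := hA.sqrt
  have hRR := hA.posSemidef.sqrt_mul_sqrt
  unfold geometricMeanFormula
  set R := CFC.sqrt A
  have hW : 0 ≤ R⁻¹ * Z * R⁻¹ := by
    have := hZ.mul_mul_conjTranspose_same R⁻¹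
    rw [hR.inv.1.eq] at this
    exact this.nonneg
  have hsq : (R⁻¹ * Z * R⁻¹) * (R⁻¹ * Z * R⁻¹) ≤ R⁻¹ * B * R⁻¹ := by
    have := conjugate_le_conjugate_of_nonneg h hR.inv.posSemidef.nonneg
    rw [← hRR, mul_inv_rev] at this
    simpa only [mul_assoc] using this
  have hle := sqrt_le_sqrt hsq
  rw [CFC.sqrt_mul_self _ hW] at hle
  have := conjugate_le_conjugate_of_nonneg hle hR.posSemidef.nonneg
  rwa [show R * (R⁻¹ * Z * R⁻¹) * R = Z by
    calc _ = (R * R⁻¹) * Z * (R⁻¹ * R) := by simp only [mul_assoc]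
      _ = Z := by rw [hR.mul_inv, hR.inv_mul, one_mul, mul_one]] at this

lemma PosDef.geometricMeanFormula_le {A A' B B' : Matrix n n ℂ} (hA : A.PosDef) (hA' : A'.PosDef)
    (hB : B.PosSemidef) (hAA' : A ≤ A') (hBB' : B ≤ B') :
    geometricMeanFormula A B ≤ geometricMeanFormula A' B' := by
  have hZ := posSemidef_geometricMeanFormula A B
  refine hA'.le_geometricMeanFormula hZ ?_
  calc _ ≤ geometricMeanFormula A B * A⁻¹ * geometricMeanFormula A B :=
        conjugate_le_conjugate_of_nonneg (hA.inv_le_inv hAA') hZ.nonneg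
    _ = B := hA.geometricMeanFormula_riccati hB
    _ ≤ B' := hBB'

lemma posSemidef_perturbedGeometricMean (A B : Matrix n n ℂ) (ε : ℝ) :
    (perturbedGeometricMean A B ε).PosSemidef :=
  posSemidef_geometricMeanFormula _ _

lemma monotoneOn_perturbedGeometricMean {A B : Matrix n n ℂ} (hA : A.PosSemidef)
    (hB : B.PosSemidef) : MonotoneOn (perturbedGeometricMean A B) (Set.Ioi 0) := by
  intro ε hε δ hδ hεδ
  have hle (X : Matrix n n ℂ) : X + ε • (1 : Matrix n n ℂ) ≤ X + δ • (1 : Matrix n n ℂ) := by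
    rw [le_iff, add_sub_add_left_eq_sub, ← sub_smul]
    exact PosSemidef.one.smul (sub_nonneg.mpr hεδ)
  exact (hA.add_smul_one_posDef hε).geometricMeanFormula_le (hA.add_smul_one_posDef hδ)
    (hB.add_smul_one_posDef hε).posSemidef (hle A) (hle B)

/-! ### Convergence of the perturbed means -/

/-- Polarization: the entries of a matrix are linear combinations of four values of its
quadratic form. -/
lemma apply_eq_polarization (M : Matrix n n ℂ) (i j : n) :
    M i j = (star (Pi.single i 1 + Pi.single j 1) ⬝ᵥ M *ᵥ (Pi.single i 1 + Pi.single j 1)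
        - Complex.I * (star (Pi.single i 1 + Pi.single j Complex.I) ⬝ᵥ
            M *ᵥ (Pi.single i 1 + Pi.single j Complex.I))
        - (1 - Complex.I) * (star (Pi.single i 1) ⬝ᵥ M *ᵥ (Pi.single i 1))
        - (1 - Complex.I) * (star (Pi.single j 1) ⬝ᵥ M *ᵥ (Pi.single j 1))) / 2 := by
  have hs (k : n) (c : ℂ) : star (Pi.single k c : n → ℂ) = Pi.single k (star c) :=
    (Pi.single_star (f := fun _ => ℂ) k c).symm
  simp only [star_add, hs, mulVec_add, add_dotProduct, dotProduct_add, mulVec_single,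
    single_dotProduct, star_one, Pi.smul_apply, col_apply]
  simp
  linear_combination (M i j - M j i - M j j * Complex.I) / 2 * Complex.I_sq

/-- A monotone family of positive semidefinite matrices converges as its parameter decreases,
because each value of the quadratic form does. -/
lemma exists_tendsto_of_monotoneOn {F : ℝ → Matrix n n ℂ} (hF : ∀ ε, (F ε).PosSemidef)
    (hmono : MonotoneOn F (Set.Ioi 0)) : ∃ L, Tendsto F (𝓝[>] (0 : ℝ)) (𝓝 L) := by
  have hq (x : n → ℂ) : ∃ l : ℂ, Tendsto (fun ε => star x ⬝ᵥ F ε *ᵥ x) (𝓝[>] (0 : ℝ)) (𝓝 l) := by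
    have hre (ε : ℝ) : star x ⬝ᵥ F ε *ᵥ x = ((star x ⬝ᵥ F ε *ᵥ x).re : ℂ) :=
      Complex.eq_re_of_ofReal_le ((hF ε).dotProduct_mulVec_nonneg x)
    have hm : MonotoneOn (fun ε => (star x ⬝ᵥ F ε *ᵥ x).re) (Set.Ioi 0) := by
      intro ε hε δ hδ h
      have := (le_iff.mp (hmono hε hδ h)).re_dotProduct_nonneg x
      rw [sub_mulVec, dotProduct_sub, map_sub] at this
      exact sub_nonneg.mp this
    have hb : BddBelow ((fun ε => (star x ⬝ᵥ F ε *ᵥ x).re) '' Set.Ioi 0) :=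
      ⟨0, by rintro _ ⟨ε, -, rfl⟩; exact (hF ε).re_dotProduct_nonneg x⟩
    refine ⟨_, Tendsto.congr (fun ε => (hre ε).symm)
      ((Complex.continuous_ofReal.tendsto _).comp (hm.tendsto_nhdsGT hb))⟩
  choose l hl using hq
  refine ⟨of fun i j => (l (Pi.single i 1 + Pi.single j 1)
        - Complex.I * l (Pi.single i 1 + Pi.single j Complex.I)
        - (1 - Complex.I) * l (Pi.single i 1) - (1 - Complex.I) * l (Pi.single j 1)) / 2, ?_⟩
  refine tendsto_pi_nhds.mpr fun i => tendsto_pi_nhds.mpr fun j => ?_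
  refine Tendsto.congr (fun ε => (apply_eq_polarization (F ε) i j).symm) ?_
  exact ((((hl _).sub ((hl _).const_mul _)).sub ((hl _).const_mul _)).sub
    ((hl _).const_mul _)).div_const 2

omit [Fintype n] in
lemma tendsto_add_smul_one (A : Matrix n n ℂ) :
    Tendsto (fun ε : ℝ => A + ε • (1 : Matrix n n ℂ)) (𝓝[>] (0 : ℝ)) (𝓝 A) := by
  have : Continuous fun ε : ℝ => A + ε • (1 : Matrix n n ℂ) := by fun_prop
  simpa using (this.tendsto 0).mono_left nhdsWithin_le_nhds

lemma PosSemidef.tendsto_sqrt {ι : Type*} {l : Filter ι} {F : ι → Matrix n n ℂ}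
    {A : Matrix n n ℂ} (hA : A.PosSemidef) (h : Tendsto F l (𝓝 A))
    (hF : ∀ᶠ i in l, (F i).PosSemidef) :
    Tendsto (fun i => CFC.sqrt (F i)) l (𝓝 (CFC.sqrt A)) :=
  (continuousOn_sqrt A hA).tendsto.comp (tendsto_nhdsWithin_iff.mpr ⟨h, hF⟩)

lemma PosSemidef.tendsto_sqrt_add_smul_one {A : Matrix n n ℂ} (hA : A.PosSemidef) :
    Tendsto (fun ε : ℝ => CFC.sqrt (A + ε • (1 : Matrix n n ℂ))) (𝓝[>] (0 : ℝ))
      (𝓝 (CFC.sqrt A)) :=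
  hA.tendsto_sqrt (tendsto_add_smul_one A) <| by
    filter_upwards [self_mem_nhdsWithin] with ε hε
    exact (hA.add_smul_one_posDef hε).posSemidef

lemma PosDef.tendsto_perturbedGeometricMean {A B : Matrix n n ℂ} (hA : A.PosDef)
    (hB : B.PosSemidef) :
    Tendsto (perturbedGeometricMean A B) (𝓝[>] (0 : ℝ)) (𝓝 (geometricMeanFormula A B)) := by
  have hR := hA.posSemidef.tendsto_sqrt_add_smul_one
  have hRinv : Tendsto (fun ε : ℝ => (CFC.sqrt (A + ε • (1 : Matrix n n ℂ)))⁻¹) (𝓝[>] (0 : ℝ))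
      (𝓝 (CFC.sqrt A)⁻¹) := by
    refine (continuousAt_matrix_inv _ ?_).tendsto.comp hR
    rw [Ring.inverse_eq_inv']
    exact continuousAt_inv₀ hA.sqrt.det_pos.ne'
  have hconj {R X : Matrix n n ℂ} (hR : R.PosSemidef) (hX : X.PosSemidef) :
      (R⁻¹ * X * R⁻¹).PosSemidef := by
    have := hX.mul_mul_conjTranspose_same R⁻¹
    rwa [hR.inv.1.eq] at this
  refine (hR.mul ((hconj (posSemidef_sqrt A) hB).tendsto_sqrt
    ((hRinv.mul (tendsto_add_smul_one B)).mul hRinv) ?_)).mul hR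
  filter_upwards [self_mem_nhdsWithin] with ε hε
  exact hconj (posSemidef_sqrt _) (hB.add_smul_one_posDef hε).posSemidef

lemma tendsto_perturbedGeometricMean {A B : Matrix n n ℂ} (hA : A.PosSemidef)
    (hB : B.PosSemidef) :
    Tendsto (perturbedGeometricMean A B) (𝓝[>] (0 : ℝ)) (𝓝 (geometricMean A B)) := by
  unfold geometricMean
  split_ifs with h
  · exact h.1.tendsto_perturbedGeometricMean hB
  · exact tendsto_nhds_limUnder (exists_tendsto_of_monotoneOn
      (posSemidef_perturbedGeometricMean A B) (monotoneOn_perturbedGeometricMean hA hB))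

end Matrix

theorem theorem2 {n : Type*} [Fintype n] [DecidableEq n] (A B : Matrix n n ℂ)
    (hA : A.PosSemidef) (hB : B.PosSemidef) :
    Tendsto (Matrix.perturbedGeometricMean A B) (𝓝[>] (0 : ℝ)) (𝓝 (Matrix.geometricMean A B)) ∧
      (1 + Matrix.geometricMean A B).det ≤ (1 + CFC.sqrt A * CFC.sqrt B).det := by
  have hlim := Matrix.tendsto_perturbedGeometricMean hA hB
  have hdet : Continuous fun M : Matrix n n ℂ => (1 + M).det :=
    (continuous_const.add continuous_id).matrix_det
  refine ⟨hlim, le_of_tendsto_of_tendsto ((hdet.tendsto _).comp hlim)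
    ((hdet.tendsto _).comp (hA.tendsto_sqrt_add_smul_one.mul hB.tendsto_sqrt_add_smul_one)) ?_⟩
  filter_upwards [self_mem_nhdsWithin] with ε hε
  exact (hA.add_smul_one_posDef hε).det_one_add_geometricMeanFormula_le
    (hB.add_smul_one_posDef hε)
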